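/- Let $X$ be a convex subset of a real vector space, equipped with an arbitrary topology (no relation to the vector space structure is required), and let $Y$ be a non-empty convex subset of a Hausdorff real topological vector space. Let $J:X\times Y\to\mathbb R$ and $\Phi:X\to\mathbb R$. Call $f:X\to\mathbb R$ inf-compact if $\{x\in X: f(x)\le \rho\}$ is compact for every $\rho\in\mathbb R$. Assume that: (i) either for every $x\in X$ the function $J(x,\cdot)$ is continuous and quasi-concave on $Y$ (that is, $\{y\in Y: J(x,y)\ge\rho\}$ is convex for every $\rho\in\mathbb R$), or for every $x\in X$ the function $J(x,\cdot)$ is concave on $Y$; (ii) $\Phi$ is lower semicontinuous and strictly convex; (iii) for every $y\in Y$ the function $J(\cdot,y)$ is convex, lower semicontinuous and has no global minimum on $X$, and for every $\lambda>0$ the function $J(\cdot,y)+\lambda\Phi(\cdot)$ is inf-compact. Then, for every real $r$ with $\inf_X\Phi<r<\sup_X\Phi$ and every closed set $S\subseteq X$ such that $$\{x\in X:\Phi(x)=r\}\subseteq S\subseteq\{x\in X:\Phi(x)\le r\},$$ one has $$\sup_{y\in Y}\inf_{x\in S}J(x,y)=\inf_{x\in S}\sup_{y\in Y}J(x,y),$$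 where suprema and infima are taken in $[-\infty,+\infty]$. -/

import Mathlib

open Set

/-- A real-valued function on a topological space is inf-compact if every sublevel set
`f ⁻¹(]-∞, r])`, `r ∈ ℝ`, is compact. -/
def IsInfCompact {X : Type*} [TopologicalSpace X] (f : X → ℝ) : Prop :=
  ∀ r : ℝ, IsCompact (f ⁻¹' Iic r)

/-! On `{Φ ≤ r}` each `J(·, y)` has exactly one minimizer, and it lies on `{Φ = r} ⊆ S`: a minimizer
with `Φ < r` would be global by convexity, and the midpoint of two minimizers would have `Φ < r`.

Uniqueness replaces convexity of `S` in the minimax argument. Over a compact convex `K`, let `y₀`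
maximize the minimal value; following segments from `y₀` shows that the minimizer at `y₀` stays
below that value on all of `K`. Thus finitely many `y` share a point of `S`, and compactness of
sublevel sets yields one point for all of `Y`. -/

/-! ### Minimax from unique minimizers -/

/-- A one-parameter family of functions with unique minimizers: a minimizer at a parameter
maximizing the minimal value stays below this value along the whole segment. -/
theorem le_at_one_of_unique_minimizers {Z : Type*} [TopologicalSpace Z] {S : Set Z}
    {φ : Z → ℝ → ℝ} {v : ℝ}
    (hcont : ∀ x ∈ S, ContinuousOn (φ x) (Icc 0 1))
    (hqc : ∀ x ∈ S, QuasiconcaveOn ℝ (Icc 0 1) (φ x))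
    (hmin : ∀ t ∈ Icc (0 : ℝ) 1, ∃ m ∈ S, φ m t ≤ v ∧ ∀ x ∈ S, x ≠ m → φ m t < φ x t)
    (hcomp : ∀ t ∈ Icc (0 : ℝ) 1, IsCompact {x | x ∈ S ∧ φ x t ≤ v})
    (hclosed : ∀ t ∈ Icc (0 : ℝ) 1, IsClosed {x | x ∈ S ∧ φ x t ≤ v})
    {x₀ : Z} (hx₀ : x₀ ∈ S) (h0 : φ x₀ 0 ≤ v) (h0' : ∀ x ∈ S, v ≤ φ x 0) :
    φ x₀ 1 ≤ v := by
  by_contra! hgt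
  have hqc' : ∀ x ∈ S, ∀ a ∈ Icc (0 : ℝ) 1, ∀ b ∈ Icc (0 : ℝ) 1, ∀ t ∈ Icc a b, ∀ w,
      w ≤ φ x a → w ≤ φ x b → w ≤ φ x t := by
    intro x hx a ha b hb t ht w hwa hwb
    exact ((hqc x hx w).ordConnected.out ⟨ha, hwa⟩ ⟨hb, hwb⟩ ht).2
  -- Parameters at which `x₀` is a minimizer with value exactly `v`; the last one, `t₀`, precedes 1.
  set A : Set ℝ := {t | t ∈ Icc (0 : ℝ) 1 ∧ φ x₀ t ≤ v} ∩
    ⋂ x ∈ S, {t | t ∈ Icc (0 : ℝ) 1 ∧ v ≤ φ x t} with hA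
  have hAclosed : IsClosed A := by
    refine IsClosed.inter ?_ (isClosed_biInter fun x hx => ?_)
    · exact (hcont x₀ hx₀).preimage_isClosed_of_isClosed isClosed_Icc isClosed_Iic
    · exact (hcont x hx).preimage_isClosed_of_isClosed isClosed_Icc isClosed_Ici
  have hAcomp : IsCompact A := isCompact_Icc.of_isClosed_subset hAclosed fun t ht => ht.1.1
  have hAne : A.Nonempty :=
    ⟨0, ⟨by simp, h0⟩, mem_iInter₂.2 fun x hx => ⟨by simp, h0' x hx⟩⟩
  obtain ⟨t₀, ⟨⟨ht₀, ht₀le⟩, ht₀ge⟩, ht₀max⟩ := hAcomp.exists_isGreatest hAne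
  have ht₀ge' : ∀ x ∈ S, v ≤ φ x t₀ := fun x hx => (mem_iInter₂.1 ht₀ge x hx).2
  have ht₀lt : t₀ < 1 := by
    refine lt_of_le_of_ne ht₀.2 ?_
    rintro rfl
    exact absurd ht₀le hgt.not_ge
  have huniq : ∀ x ∈ S, φ x t₀ ≤ v → x = x₀ := by
    obtain ⟨m, hm, -, hmu⟩ := hmin t₀ ht₀
    have key : ∀ x ∈ S, φ x t₀ ≤ v → x = m := by
      intro x hx hxv
      by_contra hne
      exact absurd (hmu x hx hne) (hxv.trans (ht₀ge' m hm)).not_gt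
    intro x hx hxv
    rw [key x hx hxv, key x₀ hx₀ ht₀le]
  have hsub : ∀ t ∈ Ioc t₀ 1, t ∈ Icc (0 : ℝ) 1 := fun t ht => ⟨ht₀.1.trans ht.1.le, ht.2⟩
  -- Past `t₀` the minimizer `m` differs from `x₀`, so it exceeds `v` at `t₀`. Being at most `v` at
  -- `t`, it cannot exceed `v` later, by quasi-concavity.
  have hexists : ∀ t ∈ Ioc t₀ 1, ∃ m ∈ S, ∀ s ∈ Icc t 1, φ m s ≤ v := by
    intro t ht
    obtain ⟨m, hm, hmv, hmu⟩ := hmin t (hsub t ht)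
    have hmne : m ≠ x₀ := by
      rintro rfl
      have hge : v ≤ φ m t := hqc' m hm t₀ ht₀ 1 (by simp) t ⟨ht.1.le, ht.2⟩ v
        (ht₀ge' m hm) hgt.le
      have : t ∈ A := by
        refine ⟨⟨hsub t ht, hmv⟩, mem_iInter₂.2 fun x hx => ⟨hsub t ht, ?_⟩⟩
        by_cases hxm : x = m
        · rwa [hxm]
        · exact hge.trans (hmu x hx hxm).le
      exact absurd (ht₀max this) ht.1.not_ge
    have hlt : v < φ m t₀ := by
      by_contra! h
      exact hmne (huniq m hm h)
    refine ⟨m, hm, fun s hs => ?_⟩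
    by_contra! hlt'
    have := hqc' m hm t₀ ht₀ s ⟨(hsub t ht).1.trans hs.1, hs.2⟩ t ⟨ht.1.le, hs.1⟩
      (min (φ m t₀) (φ m s)) (min_le_left _ _) (min_le_right _ _)
    exact absurd (lt_min hlt hlt') (this.trans hmv).not_gt
  have h1 : (1 : ℝ) ∈ Ioc t₀ 1 := ⟨ht₀lt, le_rfl⟩
  have : Nonempty (Ioc t₀ 1) := ⟨⟨1, h1⟩⟩
  obtain ⟨x₁, hx₁, hx₁'⟩ := (hcomp 1 (hsub 1 h1)).inter_iInter_nonempty
    (fun s : Ioc t₀ 1 => {x | x ∈ S ∧ φ x s ≤ v}) (fun s => hclosed s (hsub s s.2)) (by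
      intro u
      obtain ⟨⟨M, hMmem⟩, hM⟩ : ∃ M, ∀ s ∈ u, M ≤ s := Finset.exists_le (α := (Ioc t₀ 1)ᵒᵈ) u
      obtain ⟨m, hm, hmv⟩ := hexists M hMmem
      exact ⟨m, ⟨hm, hmv 1 ⟨hMmem.2, le_rfl⟩⟩,
        mem_iInter₂.2 fun s hs => ⟨hm, hmv s ⟨hM s hs, s.2.2⟩⟩⟩)
  -- Letting `s` decrease to `t₀` makes `x₁` a minimizer there, hence equal to `x₀`, which exceeds
  -- `v` at 1.
  have hx₁t : φ x₁ t₀ ≤ v := by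
    have hc : IsClosed {t | t ∈ Icc (0 : ℝ) 1 ∧ φ x₁ t ≤ v} :=
      (hcont x₁ hx₁.1).preimage_isClosed_of_isClosed isClosed_Icc isClosed_Iic
    have hsubset : closure (Ioc t₀ 1) ⊆ {t | t ∈ Icc (0 : ℝ) 1 ∧ φ x₁ t ≤ v} :=
      hc.closure_subset_iff.2 fun s hs => ⟨hsub s hs, (mem_iInter.1 hx₁' ⟨s, hs⟩).2⟩
    rw [closure_Ioc ht₀lt.ne] at hsubset
    exact (hsubset (left_mem_Icc.2 ht₀lt.le)).2
  rw [huniq x₁ hx₁.1 hx₁t] at hx₁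
  exact absurd hx₁.2 hgt.not_ge

/-- `f` has a unique minimizer on `S`, with value at most `v`, and its sublevel sets in `S`
are compact and closed. -/
structure HasUniqueMinimizerBelow {Z : Type*} [TopologicalSpace Z] (S : Set Z) (v : ℝ)
    (f : Z → ℝ) : Prop where
  exists_minimizer : ∃ m ∈ S, f m ≤ v ∧ ∀ x ∈ S, x ≠ m → f m < f x
  isCompact_sublevel : ∀ ρ, IsCompact {x | x ∈ S ∧ f x ≤ ρ}
  isClosed_sublevel : ∀ ρ, IsClosed {x | x ∈ S ∧ f x ≤ ρ}

/-- Minimax principle for functions with unique minimizers in the first variable, over a compact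
convex set in the second variable. -/
theorem exists_forall_le_of_isCompact {Z : Type*} [TopologicalSpace Z] {S : Set Z}
    {G : Type*} [AddCommGroup G] [Module ℝ G] [TopologicalSpace G]
    [IsTopologicalAddGroup G] [ContinuousSMul ℝ G] {K : Set G} (hK : IsCompact K)
    (hKconv : Convex ℝ K) (hKne : K.Nonempty) {H : Z → G → ℝ} {v : ℝ}
    (hcont : ∀ x ∈ S, ContinuousOn (H x) K) (hqc : ∀ x ∈ S, QuasiconcaveOn ℝ K (H x))
    (hmin : ∀ y ∈ K, HasUniqueMinimizerBelow S v (fun x => H x y)) :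
    ∃ x ∈ S, ∀ y ∈ K, H x y ≤ v := by
  have : Nonempty Z := ⟨(hmin _ hKne.choose_spec).exists_minimizer.choose⟩
  choose! m hmS hmv hmu using fun y hy => (hmin y hy).exists_minimizer
  have hle : ∀ y ∈ K, ∀ x ∈ S, H (m y) y ≤ H x y := by
    intro y hy x hx
    by_cases hxm : x = m y
    · rw [hxm]
    · exact (hmu y hy x hx hxm).le
  have husc : UpperSemicontinuousOn (fun y => H (m y) y) K := by
    intro y hy w hw
    filter_upwards [(hcont (m y) (hmS y hy)) y hy |>.eventually_lt_const hw,
      self_mem_nhdsWithin] with z hz hzK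
    exact (hle z hzK _ (hmS y hy)).trans_lt hz
  obtain ⟨y₀, hy₀, hmax⟩ := husc.exists_isMaxOn hKne hK
  refine ⟨m y₀, hmS y₀ hy₀, fun y hy => le_trans ?_ (hmv y₀ hy₀)⟩
  have hmaps : MapsTo (AffineMap.lineMap y₀ y : ℝ →ᵃ[ℝ] G) (Icc 0 1) K :=
    fun t ht => hKconv.lineMap_mem hy₀ hy ht
  have hline : Continuous (AffineMap.lineMap y₀ y : ℝ →ᵃ[ℝ] G) :=
    AffineMap.lineMap_continuous
  have key := le_at_one_of_unique_minimizers (S := S) (v := H (m y₀) y₀) (x₀ := m y₀)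
    (φ := fun x t => H x (AffineMap.lineMap y₀ y t))
    (fun x hx => (hcont x hx).comp hline.continuousOn hmaps)
    (fun x hx w => by
      have := (convex_Icc (0 : ℝ) 1).inter
        ((hqc x hx w).affine_preimage (AffineMap.lineMap y₀ y : ℝ →ᵃ[ℝ] G))
      convert! this using 1
      ext t
      exact ⟨fun h => ⟨h.1, hmaps h.1, h.2⟩, fun h => ⟨h.1, h.2.2⟩⟩)
    (fun t ht => ⟨_, hmS _ (hmaps ht), hmax (hmaps ht), hmu _ (hmaps ht)⟩)
    (fun t ht => (hmin _ (hmaps ht)).isCompact_sublevel _)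
    (fun t ht => (hmin _ (hmaps ht)).isClosed_sublevel _)
    (hmS y₀ hy₀) (by simp) (by simpa using hle y₀ hy₀)
  simpa using key

/-! ### Concave functions, possibly discontinuous at the boundary -/

/-- Concave functions on a convex set with nonempty interior: finitely many points. -/
theorem exists_forall_le_of_concaveOn {Z : Type*} [TopologicalSpace Z] {S : Set Z}
    {G : Type*} [NormedAddCommGroup G] [NormedSpace ℝ G] [FiniteDimensional ℝ G] {D : Set G}
    (hD : Convex ℝ D) (hDint : (interior D).Nonempty) {H : Z → G → ℝ} {v c : ℝ} (hvc : v < c)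
    (hconc : ∀ x ∈ S, ConcaveOn ℝ D (H x))
    (hmin : ∀ y ∈ D, HasUniqueMinimizerBelow S v (fun x => H x y))
    {P : Set G} (hP : P.Finite) (hPne : P.Nonempty) (hPD : P ⊆ D) :
    ∃ x ∈ S, ∀ y ∈ P, H x y ≤ c := by
  obtain ⟨z, hz⟩ := hDint
  have hzD := interior_subset hz
  obtain ⟨m, hm, hmv, hmu⟩ := (hmin z hzD).exists_minimizer
  have hle : ∀ x ∈ S, H m z ≤ H x z := by
    intro x hx
    by_cases hxm : x = m
    · rw [hxm]
    · exact (hmu x hx hxm).le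
  have hden : 0 < c - H m z + 1 := by linarith
  -- Moving the points a fraction `ε` towards `z` places them in the interior, where concave
  -- functions are continuous. Undoing the move raises the bound from `v` to at most `c`, because `H
  -- x z ≥ H m z` uniformly in `x`; the `+ 1` keeps `ε < 1`.
  set ε : ℝ := (c - v) / (c - H m z + 1) with hε
  have hεpos : 0 < ε := div_pos (by linarith) hden
  have hεlt : ε < 1 := by rw [hε, div_lt_one hden]; linarith
  have hεmul : ε * (c - H m z + 1) = c - v := div_mul_cancel₀ _ hden.ne'
  set Q : Set G := (fun p => (1 - ε) • p + ε • z) '' P with hQ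
  have hQD : Q ⊆ interior D := by
    rintro _ ⟨p, hp, rfl⟩
    exact hD.combo_self_interior_mem_interior (hPD hp) hz (by linarith) hεpos (by ring)
  have hKD : convexHull ℝ Q ⊆ interior D := convexHull_min hQD hD.interior
  obtain ⟨x, hx, hxv⟩ := exists_forall_le_of_isCompact (S := S) (H := H) (v := v)
    ((hP.image _).isCompact_convexHull (𝕜 := ℝ)) (convex_convexHull ℝ Q) (hPne.image _).convexHull
    (fun x hx => (hconc x hx).continuousOn_interior.mono hKD)
    (fun x hx => ((hconc x hx).subset (hKD.trans interior_subset)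
      (convex_convexHull ℝ Q)).quasiconcaveOn)
    (fun y hy => hmin y (interior_subset (hKD hy)))
  refine ⟨x, hx, fun p hp => ?_⟩
  have h1 := hxv _ (subset_convexHull ℝ Q ⟨p, hp, rfl⟩)
  have h2 := (hconc x hx).2 (hPD hp) hzD (by linarith : 0 ≤ 1 - ε) hεpos.le (by ring)
  simp only [smul_eq_mul] at h1 h2
  have h3 : ε * H m z ≤ ε * H x z := mul_le_mul_of_nonneg_left (hle x hx) hεpos.le
  have h4 : (1 - ε) * H x p ≤ (1 - ε) * c := by nlinarith
  exact le_of_mul_le_mul_left h4 (by linarith)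

/-- Finitely many points of a convex set are images, under an affine map from a coordinate space,
of points of a convex set with nonempty interior that is mapped into the convex set. -/
theorem exists_affineMap_preimage_interior_nonempty {F : Type*} [AddCommGroup F] [Module ℝ F]
    {Y : Set F} (hY : Convex ℝ Y) {b : F} (hb : b ∈ Y) (t : Finset F) (ht : ↑t ⊆ Y) :
    ∃ A : (t → ℝ) →ᵃ[ℝ] F, (interior (A ⁻¹' Y)).Nonempty ∧ ∀ y ∈ t, ∃ σ, A σ = y := by
  classical
  set L : (t → ℝ) →ₗ[ℝ] F := ∑ i : t, (LinearMap.proj i).smulRight ((i : F) - b)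
  have hL : ∀ σ, L σ = ∑ i : t, σ i • ((i : F) - b) := fun σ => by
    simp [L, LinearMap.sum_apply]
  refine ⟨L.toAffineMap + AffineMap.const ℝ (t → ℝ) b, ?_, ?_⟩
  · have hopen : IsOpen {σ : t → ℝ | (∀ i, 0 < σ i) ∧ ∑ i, σ i < 1} := by
      refine IsOpen.and ?_ ?_
      · simp only [ofPred_forall]
        exact isOpen_iInter_of_finite fun i => isOpen_lt continuous_const (continuous_apply i)
      · exact isOpen_lt (by fun_prop) continuous_const
    refine ⟨fun _ => 1 / ((Fintype.card t : ℝ) + 1),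
      interior_maximal ?_ hopen ⟨fun i => by positivity, ?_⟩⟩
    · rintro σ ⟨hσ, hσ1⟩
      have hmem := hY.sum_mem (t := Finset.univ) (w := fun o : Option t => o.elim (1 - ∑ i, σ i) σ)
        (z := fun o : Option t => o.elim b (fun i => (i : F)))
        (by rintro (_ | i) -; exacts [sub_nonneg.2 hσ1.le, (hσ i).le])
        (by simp) (by rintro (_ | i) -; exacts [hb, ht i.2])
      simp only [Fintype.sum_option, Option.elim] at hmem
      simp only [mem_preimage, AffineMap.coe_add, Pi.add_apply, LinearMap.coe_toAffineMap,
        AffineMap.const_apply, hL]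
      convert hmem using 1
      simp only [smul_sub, Finset.sum_sub_distrib, ← Finset.sum_smul, sub_smul, one_smul]
      abel
    · rw [Finset.sum_const, Finset.card_univ, nsmul_eq_mul, mul_one_div, div_lt_one (by positivity)]
      linarith
  · intro y hy
    refine ⟨Pi.single ⟨y, hy⟩ 1, ?_⟩
    simp [hL, Pi.single_apply]

/-! ### Minimizers on sublevel sets -/

/-- A convex function without global minimum has, on a sublevel set of a strictly convex
function, at most one minimizer, which lies on the level set; compactness gives existence. -/
theorem exists_unique_minimizer_on_sublevel {E : Type*} [AddCommGroup E] [Module ℝ E]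
    (X : Set E) [TopologicalSpace ↥X] {f Φ : E → ℝ}
    (hΦ : StrictConvexOn ℝ X Φ) (hf : ConvexOn ℝ X f)
    (hf_lsc : LowerSemicontinuous (fun x : ↥X => f x))
    (hf_nomin : ¬ ∃ x ∈ X, IsMinOn f X x) {r : ℝ}
    (hcomp : ∀ ρ, IsCompact {x : ↥X | Φ x ≤ r ∧ f x ≤ ρ}) {x₁ : ↥X} (hx₁ : Φ x₁ ≤ r) :
    ∃ m : ↥X, Φ m = r ∧ ∀ x : ↥X, Φ x ≤ r → x ≠ m → f m < f x := by
  have hlevel : ∀ m : ↥X, Φ m ≤ r → (∀ x : ↥X, Φ x ≤ r → f m ≤ f x) → Φ m = r := by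
    intro m hm hmin
    by_contra hne
    have hlt : Φ m < r := lt_of_le_of_ne hm hne
    refine hf_nomin ⟨m, m.2, fun z hz => ?_⟩
    by_contra hzm
    simp only [mem_ofPred_eq, not_le] at hzm
    -- A step towards `z` short enough to keep `Φ ≤ r` still lowers `f`.
    obtain ⟨t, ht0, ht1, ht⟩ : ∃ t : ℝ, 0 < t ∧ t < 1 ∧ t * (Φ z - Φ m) ≤ r - Φ m := by
      have hden : 0 < |Φ z - Φ m| + (r - Φ m) + 1 := by positivity [abs_nonneg (Φ z - Φ m)]
      refine ⟨(r - Φ m) / (|Φ z - Φ m| + (r - Φ m) + 1), div_pos (by linarith) hden, ?_, ?_⟩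
      · rw [div_lt_one hden]; linarith [abs_nonneg (Φ z - Φ m)]
      · rw [div_mul_eq_mul_div, div_le_iff₀ hden]
        exact mul_le_mul_of_nonneg_left (by linarith [le_abs_self (Φ z - Φ m)]) (by linarith)
    have hw := hΦ.1 m.2 hz (by linarith : 0 ≤ 1 - t) ht0.le (by ring)
    have h1 := hΦ.convexOn.2 m.2 hz (by linarith : 0 ≤ 1 - t) ht0.le (by ring)
    have h2 := hf.2 m.2 hz (by linarith : 0 ≤ 1 - t) ht0.le (by ring)
    have h3 := hmin ⟨_, hw⟩ (by simp only [smul_eq_mul] at h1 ⊢; linarith)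
    simp only [smul_eq_mul] at h2 h3
    nlinarith
  obtain ⟨m, hm, hmin⟩ := (hf_lsc.lowerSemicontinuousOn _).exists_isMinOn
    (s := {x : ↥X | Φ x ≤ r ∧ f x ≤ f x₁}) ⟨x₁, hx₁, le_rfl⟩ (hcomp _)
  have hmin' : ∀ x : ↥X, Φ x ≤ r → f m ≤ f x := by
    intro x hx
    by_cases h : f x ≤ f x₁
    · exact hmin ⟨hx, h⟩
    · exact hm.2.trans (not_le.1 h).le
  refine ⟨m, hlevel m hm.1 hmin', fun x hx hne => ?_⟩
  by_contra hle
  rw [not_lt] at hle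
  have hne' : (x : E) ≠ m := fun h => hne (Subtype.ext h)
  have hw := hΦ.1 x.2 m.2 (by norm_num : (0 : ℝ) ≤ 1 / 2) (by norm_num : (0 : ℝ) ≤ 1 / 2)
    (by norm_num)
  have h1 := hΦ.2 x.2 m.2 hne' (by norm_num : (0 : ℝ) < 1 / 2) (by norm_num : (0 : ℝ) < 1 / 2)
    (by norm_num)
  have h2 := hf.2 x.2 m.2 (by norm_num : (0 : ℝ) ≤ 1 / 2) (by norm_num : (0 : ℝ) ≤ 1 / 2)
    (by norm_num)
  simp only [smul_eq_mul] at h1 h2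
  have hm1 := hm.1
  have h3 := hlevel ⟨_, hw⟩ (by simp only; linarith) fun y hy => by
    have := hmin' y hy
    simp only
    linarith
  simp only at h3
  linarith

/-! ### The minimax equality -/

/-- `X` carries an arbitrary topology, unrelated to the vector space `E` that contains it.
Only the values of `Φ` on `X` and of `J` on `X × Y` enter. Infima and suprema are taken in the
extended reals. -/
theorem corollary2p2
    {E : Type*} [AddCommGroup E] [Module ℝ E]
    {F : Type*} [AddCommGroup F] [Module ℝ F] [TopologicalSpace F]
    [IsTopologicalAddGroup F] [ContinuousSMul ℝ F] [T2Space F]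
    (X : Set E) [TopologicalSpace ↥X] (hX : Convex ℝ X)
    (Y : Set F) (hY : Convex ℝ Y) (hYne : Y.Nonempty)
    (J : E → F → ℝ) (Φ : E → ℝ)
    (hJY : (∀ x ∈ X, ContinuousOn (J x) Y ∧ QuasiconcaveOn ℝ Y (J x)) ∨
      (∀ x ∈ X, ConcaveOn ℝ Y (J x)))
    (hΦ_lsc : LowerSemicontinuous (fun x : ↥X => Φ x))
    (hΦ_conv : StrictConvexOn ℝ X Φ)
    (hJ_conv : ∀ y ∈ Y, ConvexOn ℝ X (fun x => J x y))
    (hJ_lsc : ∀ y ∈ Y, LowerSemicontinuous (fun x : ↥X => J x y))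
    (hJ_nomin : ∀ y ∈ Y, ¬ ∃ x ∈ X, IsMinOn (fun x => J x y) X x)
    (hJ_comp : ∀ l : ℝ, 0 < l → ∀ y ∈ Y, IsInfCompact (fun x : ↥X => J x y + l * Φ x))
    (r : ℝ)
    (hr_inf : (⨅ x : ↥X, (Φ x : EReal)) < (r : EReal))
    (hr_sup : (r : EReal) < ⨆ x : ↥X, (Φ x : EReal))
    (S : Set ↥X) (hS : IsClosed S)
    (hS_lower : {x : ↥X | Φ x = r} ⊆ S)
    (hS_upper : S ⊆ {x : ↥X | Φ x ≤ r}) :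
    (⨆ y ∈ Y, ⨅ x ∈ S, (J x y : EReal)) = ⨅ x ∈ S, ⨆ y ∈ Y, (J x y : EReal) := by
  obtain ⟨x₁, hx₁⟩ := iInf_lt_iff.1 hr_inf
  have hx₁r : Φ x₁ ≤ r := (EReal.coe_lt_coe_iff.1 hx₁).le
  have hclosed : ∀ y ∈ Y, ∀ ρ, IsClosed {x : ↥X | x ∈ S ∧ J x y ≤ ρ} := fun y hy ρ =>
    hS.inter ((hJ_lsc y hy).isClosed_preimage ρ)
  have hcompC : ∀ y ∈ Y, ∀ ρ, IsCompact {x : ↥X | Φ x ≤ r ∧ J x y ≤ ρ} := by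
    intro y hy ρ
    refine (hJ_comp 1 one_pos y hy (ρ + r)).of_isClosed_subset
      ((hΦ_lsc.isClosed_preimage r).inter ((hJ_lsc y hy).isClosed_preimage ρ)) ?_
    rintro x ⟨h1, h2⟩
    simp only [mem_preimage, mem_Iic] at h1 h2 ⊢
    linarith
  have hcomp : ∀ y ∈ Y, ∀ ρ, IsCompact {x : ↥X | x ∈ S ∧ J x y ≤ ρ} := fun y hy ρ =>
    (hcompC y hy ρ).of_isClosed_subset (hclosed y hy ρ) fun x hx => ⟨hS_upper hx.1, hx.2⟩
  refine le_antisymm ?_ ?_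
  · exact iSup₂_le fun y hy => le_iInf₂ fun x hx =>
      (iInf₂_le x hx).trans (le_iSup₂ (f := fun y _ => (J x y : EReal)) y hy)
  by_contra! hlt
  obtain ⟨v, hv, hv'⟩ := EReal.lt_iff_exists_real_btwn.1 hlt
  -- The gap between `v` and `c` is the slack spent in the concave case.
  obtain ⟨c, hvc, hc⟩ := EReal.lt_iff_exists_real_btwn.1 hv'
  rw [EReal.coe_lt_coe_iff] at hvc
  have hmin : ∀ y ∈ Y, HasUniqueMinimizerBelow S v (fun x : ↥X => J x y) := by
    intro y hy
    obtain ⟨m, hm, hmu⟩ := exists_unique_minimizer_on_sublevel X hΦ_conv (hJ_conv y hy)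
      (hJ_lsc y hy) (hJ_nomin y hy) (hcompC y hy) hx₁r
    have hmu' : ∀ x ∈ S, x ≠ m → J m y < J x y := fun x hx => hmu x (hS_upper hx)
    refine ⟨⟨m, hS_lower hm, ?_, hmu'⟩, hcomp y hy, hclosed y hy⟩
    have h1 : (⨅ x ∈ S, (J x y : EReal)) < v :=
      (le_iSup₂ (f := fun y _ => ⨅ x ∈ S, (J x y : EReal)) y hy).trans_lt hv
    obtain ⟨x, hx⟩ := iInf_lt_iff.1 h1
    obtain ⟨hxS, hxv⟩ := iInf_lt_iff.1 hx
    rw [EReal.coe_lt_coe_iff] at hxv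
    by_cases hxm : x = m
    · exact hxm ▸ hxv.le
    · exact ((hmu' x hxS hxm).trans hxv).le
  have hfin : ∀ t : Finset F, ↑t ⊆ Y → t.Nonempty → ∃ x ∈ S, ∀ y ∈ t, J x y ≤ c := by
    intro t htY htne
    rcases hJY with hJ | hJ
    · have hsub : convexHull ℝ (t : Set F) ⊆ Y := convexHull_min htY hY
      obtain ⟨x, hx, hxv⟩ := exists_forall_le_of_isCompact (S := S)
        (H := fun (x : ↥X) y => J x y) (v := v)
        (t.finite_toSet.isCompact_convexHull (𝕜 := ℝ)) (convex_convexHull ℝ (t : Set F))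
        (Finset.coe_nonempty.2 htne).convexHull
        (fun x _ => (hJ x x.2).1.mono hsub)
        (fun x _ w => by
          convert! (convex_convexHull ℝ (t : Set F)).inter ((hJ x x.2).2 w) using 1
          ext y
          exact ⟨fun h => ⟨h.1, hsub h.1, h.2⟩, fun h => ⟨h.1, h.2.2⟩⟩)
        (fun y hy => hmin y (hsub hy))
      exact ⟨x, hx, fun y hy => (hxv y (subset_convexHull ℝ _ hy)).trans hvc.le⟩
    · obtain ⟨A, hAint, hA⟩ :=
        exists_affineMap_preimage_interior_nonempty hY hYne.choose_spec t htY
      choose! σ hσ using hA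
      obtain ⟨x, hx, hxc⟩ := exists_forall_le_of_concaveOn (S := S)
        (H := fun (x : ↥X) p => J x (A p)) (P := σ '' t) (hY.affine_preimage A) hAint hvc
        (fun x _ => (hJ x x.2).comp_affineMap A) (fun p hp => hmin (A p) hp)
        (t.finite_toSet.image σ) ((Finset.coe_nonempty.2 htne).image σ)
        (by rintro _ ⟨y, hy, rfl⟩; rw [mem_preimage, hσ y hy]; exact htY hy)
      exact ⟨x, hx, fun y hy => by simpa [hσ y hy] using hxc _ ⟨y, hy, rfl⟩⟩
  obtain ⟨y₀, hy₀⟩ := hYne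
  obtain ⟨x, hx, hx'⟩ := (hcomp y₀ hy₀ c).inter_iInter_nonempty
    (fun y : Y => {x : ↥X | x ∈ S ∧ J x y ≤ c}) (fun y => hclosed y y.2 c) (by
      classical
      intro u
      obtain ⟨x, hx, hxc⟩ := hfin (insert y₀ (u.image Subtype.val))
        (by
          intro y hy
          simp only [Finset.coe_insert, Finset.coe_image, mem_insert_iff, mem_image] at hy
          obtain rfl | ⟨z, -, rfl⟩ := hy
          exacts [hy₀, z.2])
        (Finset.insert_nonempty _ _)
      exact ⟨x, ⟨hx, hxc y₀ (Finset.mem_insert_self _ _)⟩, mem_iInter₂.2 fun y hy =>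
        ⟨hx, hxc y (Finset.mem_insert_of_mem (Finset.mem_image_of_mem _ hy))⟩⟩)
  refine absurd hc (not_lt.2 ((iInf₂_le x hx.1).trans (iSup₂_le fun y hy => ?_)))
  exact EReal.coe_le_coe_iff.2 (mem_iInter.1 hx' ⟨y, hy⟩).2
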